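/- Let $H$ be a complex Hilbert space, let $A,B$ be compact operators on $H$, and let $0\le\alpha\le1$. Then for every $j=1,2,\ldots$ $$s_j(A+B)\le s_j\Big(\big(|A|^{2\alpha}+|B|^{2\alpha}\big)\oplus\big(|A^*|^{2(1-\alpha)}+|B^*|^{2(1-\alpha)}\big)\Big).$$ Here $|T|=(T^*T)^{1/2}$, the powers are defined by the continuous functional calculus (so $|T|^0=I$), and $S\oplus T$ is the block diagonal operator $(x,y)\mapsto(Sx,Ty)$ on the Hilbert space $H\oplus H$. The $j$-th singular value $s_j(T)$ is the $j$-th largest eigenvalue of $|T|$, eigenvalues being repeated according to multiplicity; that is, $s_j(T)$ is the infimum of all $t\ge0$ such that fewer than $j$ eigenvalues of $|T|$, counted with multiplicity, exceed $t$. In particular, $s_j(T)=0$ if $|T|$ has fewer than $j$ positive eigenvalues. (For $\alpha\in\{0,1\}$ one summand on the right is $2I$ and the other one is compact; the same definition of $s_j$ applies.) -/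

import Mathlib

/-- The span of all eigenspaces of `|T| = (T* T)^{1/2}` belonging to eigenvalues `μ > t`.
Eigenspaces for distinct eigenvalues are linearly independent, so its dimension is the number of
eigenvalues of `|T|` larger than `t`, repeated according to multiplicity. -/
noncomputable def absEigenspan {H : Type*} [NormedAddCommGroup H] [InnerProductSpace ℂ H] [CompleteSpace H]
    (T : H →L[ℂ] H) (t : ℝ) : Submodule ℂ H :=
  ⨆ μ : ℝ, ⨆ _ : t < μ,
    Module.End.eigenspace ((CFC.abs T : H →L[ℂ] H) : Module.End ℂ H) (μ : ℂ)

/-- The `j`-th singular value `s_j(T)`, `j = 1, 2, …`: the `j`-th largest eigenvalue of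
`|T| = (T* T)^{1/2}`, the eigenvalues being repeated according to multiplicity. It is the least
`t ≥ 0` such that fewer than `j` eigenvalues of `|T|`, counted with multiplicity, are larger
than `t`; in particular it is `0` if `|T|` has fewer than `j` positive eigenvalues.

For compact `T` these are the usual singular values. For `T = K ⊕ c I` with `K` compact and `c ≥ 0`
the eigenvectors of `|T|` span a dense subspace, and the definition returns the decreasing
rearrangement of the singular values of `K` together with those of `c I`, as usual. For bounded
operators whose `|T|` has continuous spectrum it is not meant to be used. -/
noncomputable def opSingularValue {H : Type*} [NormedAddCommGroup H] [InnerProductSpace ℂ H]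
    [CompleteSpace H] (T : H →L[ℂ] H) (j : ℕ) : ℝ :=
  sInf {t : ℝ | 0 ≤ t ∧ Module.rank ℂ (absEigenspan T t) < (j : Cardinal)}

/-- The direct sum `S ⊕ T`, that is the block diagonal operator `(x, y) ↦ (S x, T y)` on the
Hilbert space direct sum `H ⊕ H`. -/
noncomputable def opDirectSum {H : Type*} [NormedAddCommGroup H] [InnerProductSpace ℂ H]
    (S T : H →L[ℂ] H) : WithLp 2 (H × H) →L[ℂ] WithLp 2 (H × H) :=
  ((WithLp.prodContinuousLinearEquiv 2 ℂ H H).symm : H × H →L[ℂ] WithLp 2 (H × H)) ∘L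
    (S.prodMap T) ∘L
      ((WithLp.prodContinuousLinearEquiv 2 ℂ H H) : WithLp 2 (H × H) →L[ℂ] H × H)

open scoped InnerProductSpace

/-! Write `T = A + B` and `R` for the block diagonal operator on the right. Adding the mixed Schwarz
inequalities for `A` and `B` (`two_re_inner_apply_le`) gives `2 Re ⟪T x, y⟫ ≤ Re ⟪R (x, y), (x,
y)⟫`. A dimension count (`rank_absEigenspan_le`) turns this into a bound on eigenvalue counts: on
the eigenspan of `|T|` above `t`, the vectors `(|T| x, T x)` have `R`-Rayleigh quotient larger than
`t`, while on the orthogonal complement of the eigenspan of `R` above `t` the quotient is at most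
`t`. Projecting onto the latter eigenspan is thus injective, so `|T|` has no more eigenvalues above
`t` than `R`. -/

theorem mul_cfc_eq_cfc_mul_of_intertwine {𝓐 : Type*} [CStarAlgebra 𝓐] {a b x : 𝓐}
    (ha : IsSelfAdjoint a) (hb : IsSelfAdjoint b) (h : x * a = b * x) {c d : ℝ} {f : ℝ → ℝ}
    (hf : ContinuousOn f (Set.Icc c d)) (hac : spectrum ℝ a ⊆ Set.Icc c d)
    (hbc : spectrum ℝ b ⊆ Set.Icc c d) : x * cfc f a = cfc f b * x := by
  have hpoly : ∀ p : Polynomial ℝ, x * cfc p.eval a = cfc p.eval b * x := by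
    intro p
    rw [cfc_polynomial p a, cfc_polynomial p b]
    have hpow : ∀ n : ℕ, x * a ^ n = b ^ n * x := fun n ↦
      (SemiconjBy.pow_right (show SemiconjBy x a b from h) n)
    rw [Polynomial.aeval_eq_sum_range, Polynomial.aeval_eq_sum_range, Finset.mul_sum,
      Finset.sum_mul]
    refine Finset.sum_congr rfl fun n _ ↦ ?_
    rw [mul_smul_comm, smul_mul_assoc, hpow]
  -- Intertwining passes from polynomials to `f` by Weierstrass approximation on an interval
  -- containing both spectra.
  rw [← sub_eq_zero, ← norm_eq_zero]
  refine le_antisymm (le_of_forall_pos_le_add fun ε hε ↦ ?_) (norm_nonneg _)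
  obtain ⟨p, hp⟩ := exists_polynomial_near_of_continuousOn c d f hf (ε / (2 * ‖x‖ + 1))
    (by positivity)
  have key : ∀ e : 𝓐, IsSelfAdjoint e → spectrum ℝ e ⊆ Set.Icc c d →
      ‖cfc f e - cfc p.eval e‖ ≤ ε / (2 * ‖x‖ + 1) := by
    intro e he hec
    rw [← cfc_sub f p.eval e (hf.mono hec) (by fun_prop)]
    refine norm_cfc_le (by positivity) fun s hs ↦ ?_
    rw [Real.norm_eq_abs, abs_sub_comm]
    exact (hp s (hec hs)).le
  have : x * cfc f a - cfc f b * x =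
      x * (cfc f a - cfc p.eval a) - (cfc f b - cfc p.eval b) * x := by
    rw [mul_sub, sub_mul, hpoly]; abel
  rw [this]
  calc _ ≤ ‖x‖ * (ε / (2 * ‖x‖ + 1)) + (ε / (2 * ‖x‖ + 1)) * ‖x‖ :=
        (norm_sub_le _ _).trans (add_le_add
          ((norm_mul_le _ _).trans (by gcongr; exact key a ha hac))
          ((norm_mul_le _ _).trans (by gcongr; exact key b hb hbc)))
    _ = ε * ((2 * ‖x‖) / (2 * ‖x‖ + 1)) := by ring
    _ ≤ ε * 1 := by
        gcongr
        rw [div_le_one (by positivity)]; linarith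
    _ = 0 + ε := by ring

/-! ### Compactness of functional calculus, and the mixed Schwarz inequality -/

section
variable {H : Type*} [NormedAddCommGroup H] [InnerProductSpace ℂ H]

theorem re_inner_apply_self_mono {S T : H →L[ℂ] H} (h : S ≤ T) (x : H) :
    (⟪S x, x⟫_ℂ).re ≤ (⟪T x, x⟫_ℂ).re := by
  have := ((ContinuousLinearMap.le_def S T).1 h).re_inner_nonneg_left x
  simpa [inner_sub_left] using this

theorem two_re_inner_le (u v : H) : 2 * (⟪u, v⟫_ℂ).re ≤ ‖u‖ ^ 2 + ‖v‖ ^ 2 := by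
  have h := norm_sub_sq (𝕜 := ℂ) u v
  have : 0 ≤ ‖u - v‖ ^ 2 := by positivity
  simp only [RCLike.re_to_complex] at h
  linarith

variable [CompleteSpace H]

theorem isCompactOperator_cfc {a : H →L[ℂ] H} (ha : IsSelfAdjoint a) (hc : IsCompactOperator a)
    {f : ℝ → ℝ} {c d : ℝ} (hf : ContinuousOn f (Set.Icc c d)) (h0 : (0 : ℝ) ∈ Set.Icc c d)
    (hf0 : f 0 = 0) (hac : spectrum ℝ a ⊆ Set.Icc c d) : IsCompactOperator (cfc f a : H →L[ℂ] H) := by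
  have hcl : IsClosed {T : H →L[ℂ] H | IsCompactOperator T} := isClosed_setOfPred_isCompactOperator
  change (cfc f a : H →L[ℂ] H) ∈ {T : H →L[ℂ] H | IsCompactOperator T}
  rw [← hcl.closure_eq, Metric.mem_closure_iff]
  intro ε hε
  obtain ⟨p, hp⟩ := exists_polynomial_near_of_continuousOn c d f hf (ε / 3) (by positivity)
  -- Dropping the constant term makes the polynomial in `a` a multiple of `a`, hence compact; since
  -- `f 0 = 0`, this costs at most another `ε / 3`.
  have hq : ∀ s, (Polynomial.X * p.divX).eval s = p.eval s - p.eval 0 := by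
    intro s
    have := congrArg (Polynomial.eval s) p.X_mul_divX_add
    simp only [Polynomial.eval_add, Polynomial.eval_C] at this
    rw [← this, Polynomial.coeff_zero_eq_eval_zero]; ring
  refine ⟨cfc (Polynomial.X * p.divX).eval a, ?_, ?_⟩
  · rw [cfc_polynomial _ a, map_mul, Polynomial.aeval_X]
    exact hc.comp_clm _
  · rw [dist_eq_norm, ← cfc_sub f _ a (hf.mono hac) (by fun_prop)]
    refine (norm_cfc_le (c := 2 * ε / 3) (by positivity) fun s hs ↦ ?_).trans_lt (by linarith)
    have h1 := hp s (hac hs)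
    have h2 := hp 0 h0
    rw [hf0, sub_zero] at h2
    rw [hq, Real.norm_eq_abs]
    rw [abs_lt] at h1 h2
    rw [abs_le]
    constructor <;> linarith [h1.1, h1.2, h2.1, h2.2]

theorem spectrum_subset_Icc_norm {a : H →L[ℂ] H} (ha : 0 ≤ a) :
    spectrum ℝ a ⊆ Set.Icc 0 ‖a‖ := by
  intro s hs
  refine ⟨spectrum_nonneg_of_nonneg ha hs, ?_⟩
  by_cases hn : Nontrivial (H →L[ℂ] H)
  · exact (le_abs_self s).trans (spectrum.norm_le_norm_of_mem hs)
  · rw [not_nontrivial_iff_subsingleton] at hn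
    exact absurd hs (by simp [spectrum.of_subsingleton])

theorem abs_rpow_two_mul (A : H →L[ℂ] H) {α : ℝ} (hα : 0 ≤ α) :
    CFC.abs A ^ (2 * α) = cfc (fun s : ℝ ↦ s ^ α) (star A * A) := by
  have h0 : 0 ≤ star A * A := star_mul_self_nonneg A
  rw [CFC.abs, CFC.sqrt_eq_rpow,
    CFC.rpow_rpow_of_exponent_nonneg _ _ _ (by norm_num) (by positivity),
    show (1 / 2 : ℝ) * (2 * α) = α by ring, CFC.rpow_eq_cfc_real]

theorem isCompactOperator_abs_rpow {A : H →L[ℂ] H} (hA : IsCompactOperator (star A * A)) {α : ℝ}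
    (hα : 0 < α) : IsCompactOperator (CFC.abs A ^ (2 * α) : H →L[ℂ] H) := by
  have h0 : 0 ≤ star A * A := star_mul_self_nonneg A
  rw [abs_rpow_two_mul A hα.le]
  exact isCompactOperator_cfc (.of_nonneg h0) hA (f := fun s : ℝ ↦ s ^ α)
    (Real.continuous_rpow_const hα.le).continuousOn ⟨le_rfl, norm_nonneg _⟩
    (Real.zero_rpow hα.ne') (spectrum_subset_Icc_norm h0)

theorem norm_sq_apply_of_isSelfAdjoint {S : H →L[ℂ] H} (hS : IsSelfAdjoint S) (x : H) :
    ‖S x‖ ^ 2 = (⟪(S * S) x, x⟫_ℂ).re := by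
  have h := (ContinuousLinearMap.isSelfAdjoint_iff_isSymmetric.1 hS) (S x) x
  simp only [ContinuousLinearMap.coe_coe] at h
  rw [mul_apply_eq_comp, h, inner_self_eq_norm_sq_to_K]
  norm_cast

theorem exists_pos_add_rpow_le {α δ : ℝ} (h0 : 0 ≤ α) (h1 : α ≤ 1) (hδ : 0 < δ) :
    ∃ ε > 0, ∀ s : ℝ, 0 ≤ s → (s + ε) ^ α ≤ s ^ α + δ := by
  rcases h0.eq_or_lt with rfl | h0
  · exact ⟨1, one_pos, fun s _ ↦ by simp [hδ.le]⟩
  · refine ⟨δ ^ α⁻¹, by positivity, fun s hs ↦ ?_⟩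
    refine (Real.rpow_add_le_add_rpow hs (by positivity) h0.le h1).trans ?_
    rw [Real.rpow_inv_rpow hδ.le h0.ne']

/-- The arithmetic-mean form of the mixed Schwarz inequality. -/
theorem two_re_inner_apply_le (A : H →L[ℂ] H) {α : ℝ} (h0 : 0 ≤ α) (h1 : α ≤ 1) (x y : H) :
    2 * (⟪A x, y⟫_ℂ).re ≤ (⟪(CFC.abs A ^ (2 * α)) x, x⟫_ℂ).re +
      (⟪(CFC.abs (ContinuousLinearMap.adjoint A) ^ (2 * (1 - α))) y, y⟫_ℂ).re := by
  rw [← ContinuousLinearMap.star_eq_adjoint, abs_rpow_two_mul A h0,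
    abs_rpow_two_mul (star A) (sub_nonneg.2 h1), star_star]
  set a := star A * A with ha_def
  set b := A * star A with hb_def
  have ha : 0 ≤ a := star_mul_self_nonneg A
  have hb : 0 ≤ b := mul_star_self_nonneg A
  refine le_of_forall_pos_le_add fun η hη ↦ ?_
  -- Shifting `a` by `ε` makes it invertible, so negative powers exist; `δ` is chosen so that the
  -- error `δ ‖x‖ ^ 2` is at most `η`.
  obtain ⟨ε, hε, hle⟩ := exists_pos_add_rpow_le (δ := η / (‖x‖ ^ 2 + 1)) h0 h1 (by positivity)
  set R := max ‖a‖ ‖b‖ with hR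
  have hsa : spectrum ℝ a ⊆ Set.Icc 0 R :=
    (spectrum_subset_Icc_norm ha).trans (Set.Icc_subset_Icc_right (le_max_left _ _))
  have hsb : spectrum ℝ b ⊆ Set.Icc 0 R :=
    (spectrum_subset_Icc_norm hb).trans (Set.Icc_subset_Icc_right (le_max_right _ _))
  have hcont : ∀ p : ℝ, ContinuousOn (fun s : ℝ ↦ (s + ε) ^ p) (Set.Icc 0 R) := fun p ↦
    ContinuousOn.rpow_const (by fun_prop) fun s hs ↦ Or.inl (by linarith [hs.1])
  have hcontp : ∀ p : ℝ, 0 ≤ p → Continuous (fun s : ℝ ↦ s ^ p) := fun p hp ↦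
    Real.continuous_rpow_const hp
  -- `F` inverts `G`, so `⟪A x, y⟫ = ⟪G x, F A* y⟫`, and the two squared norms give the two terms.
  set G := cfc (fun s : ℝ ↦ (s + ε) ^ (α / 2)) a with hG
  set F := cfc (fun s : ℝ ↦ (s + ε) ^ (-(α / 2))) a with hF
  have hGs : IsSelfAdjoint G := cfc_predicate _ a
  have hFs : IsSelfAdjoint F := cfc_predicate _ a
  have hmul : ∀ p q : ℝ, cfc (fun s : ℝ ↦ (s + ε) ^ p) a * cfc (fun s : ℝ ↦ (s + ε) ^ q) a =
      cfc (fun s : ℝ ↦ (s + ε) ^ (p + q)) a := by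
    intro p q
    rw [← cfc_mul _ _ a ((hcont p).mono hsa) ((hcont q).mono hsa)]
    refine cfc_congr fun s hs ↦ ?_
    exact (Real.rpow_add (by linarith [(hsa hs).1]) _ _).symm
  have hFG : F * G = 1 := by
    rw [hF, hG, hmul]
    simp [cfc_const_one ℝ a]
  have hGG : G * G ≤ cfc (fun s : ℝ ↦ s ^ α) a + algebraMap ℝ _ (η / (‖x‖ ^ 2 + 1)) := by
    rw [hG, hmul, add_halves,
      ← cfc_add_const _ _ a ((hcontp α h0).continuousOn)]
    refine cfc_mono (fun s hs ↦ hle s (hsa hs).1) ((hcont α).mono hsa) ?_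
    exact ((hcontp α h0).add continuous_const).continuousOn
  -- Since `A a = b A`, the left side is `(b + ε) ^ (-α) b`.
  have hAF : A * (F * F) * star A ≤ cfc (fun s : ℝ ↦ s ^ (1 - α)) b := by
    rw [hF, hmul, mul_cfc_eq_cfc_mul_of_intertwine (.of_nonneg ha) (.of_nonneg hb)
      (by rw [ha_def, hb_def, mul_assoc]) (hcont _) hsa hsb, mul_assoc, ← hb_def]
    nth_rw 2 [← cfc_id' ℝ b]
    rw [← cfc_mul _ _ b ((hcont _).mono hsb) (by fun_prop)]
    refine cfc_mono (fun s hs ↦ ?_) (((hcont _).mono hsb).mul (by fun_prop))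
      (hcontp _ (sub_nonneg.2 h1)).continuousOn
    have hs0 : 0 ≤ s := (hsb hs).1
    rcases hs0.eq_or_lt with rfl | hs0
    · simpa using Real.rpow_nonneg le_rfl _
    · calc (s + ε) ^ (-(α / 2) + -(α / 2)) * s = (s + ε) ^ (-α) * s := by ring_nf
        _ ≤ s ^ (-α) * s := by
          gcongr ?_ * s
          exact Real.rpow_le_rpow_of_nonpos hs0 (by linarith) (by linarith)
        _ = s ^ (1 - α) := by
          rw [sub_eq_neg_add, Real.rpow_add hs0, Real.rpow_one]
  have e1 : ⟪A x, y⟫_ℂ = ⟪G x, F (star A y)⟫_ℂ := by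
    have e2 := (ContinuousLinearMap.isSelfAdjoint_iff_isSymmetric.1 hFs) (G x) (star A y)
    simp only [ContinuousLinearMap.coe_coe] at e2
    rw [← e2, ContinuousLinearMap.star_eq_adjoint, ContinuousLinearMap.adjoint_inner_right,
      ← mul_apply_eq_comp F G, hFG, one_apply_eq_self]
  have e3 : ‖F (star A y)‖ ^ 2 = (⟪(A * (F * F) * star A) y, y⟫_ℂ).re := by
    rw [norm_sq_apply_of_isSelfAdjoint hFs, mul_apply_eq_comp _ (star A) y,
      mul_apply_eq_comp A, ContinuousLinearMap.star_eq_adjoint,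
      ContinuousLinearMap.adjoint_inner_right]
  have e4 := re_inner_apply_self_mono hAF y
  have e5 := re_inner_apply_self_mono hGG x
  have e6 : (⟪(algebraMap ℝ (H →L[ℂ] H) (η / (‖x‖ ^ 2 + 1))) x, x⟫_ℂ).re ≤ η := by
    rw [Algebra.algebraMap_eq_smul_one, smul_apply,
      one_apply_eq_self, ← Complex.coe_smul, inner_smul_left, Complex.conj_ofReal,
      Complex.re_ofReal_mul, ← RCLike.re_to_complex, inner_self_eq_norm_sq,
      div_mul_eq_mul_div, div_le_iff₀ (by positivity)]
    nlinarith
  rw [add_apply, inner_add_left, Complex.add_re] at e5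
  have e7 := two_re_inner_le (G x) (F (star A y))
  rw [← e1, e3, norm_sq_apply_of_isSelfAdjoint hGs] at e7
  linarith
end

/-! ### Eigenspans, Rayleigh quotients and the dimension count -/

section
variable {H : Type*} [NormedAddCommGroup H] [InnerProductSpace ℂ H]

/-- The span of the eigenspaces of `P` belonging to real eigenvalues larger than `t`. -/
noncomputable def upperEigenspan (P : H →L[ℂ] H) (t : ℝ) : Submodule ℂ H :=
  ⨆ μ : ℝ, ⨆ _ : t < μ, Module.End.eigenspace (P : Module.End ℂ H) (μ : ℂ)

theorem eigenspace_le_upperEigenspan (P : H →L[ℂ] H) {t μ : ℝ} (h : t < μ) :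
    Module.End.eigenspace (P : Module.End ℂ H) (μ : ℂ) ≤ upperEigenspan P t :=
  le_iSup₂_of_le (f := fun (μ : ℝ) (_ : t < μ) ↦
    Module.End.eigenspace (P : Module.End ℂ H) (μ : ℂ)) μ h le_rfl

theorem apply_mem_upperEigenspan (P : H →L[ℂ] H) (t : ℝ) {x : H} (hx : x ∈ upperEigenspan P t) :
    P x ∈ upperEigenspan P t := by
  have : upperEigenspan P t ≤ (upperEigenspan P t).comap (P : H →ₗ[ℂ] H) := by
    refine iSup₂_le fun μ hμ y hy ↦ ?_
    have hy' : P y = (μ : ℂ) • y := Module.End.mem_eigenspace_iff.1 hy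
    change P y ∈ upperEigenspan P t
    rw [hy']
    exact Submodule.smul_mem _ _ (eigenspace_le_upperEigenspan P hμ hy)
  exact this hx

theorem apply_mem_upperEigenspan_orthogonal {P : H →L[ℂ] H} (hP : (P : H →ₗ[ℂ] H).IsSymmetric)
    (t : ℝ) {x : H} (hx : x ∈ (upperEigenspan P t)ᗮ) : P x ∈ (upperEigenspan P t)ᗮ := by
  rw [Submodule.mem_orthogonal] at hx ⊢
  intro u hu
  have := hP u x
  simp only [ContinuousLinearMap.coe_coe] at this
  rw [← this]
  exact hx _ (apply_mem_upperEigenspan P t hu)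

/-- Expand in the mutually orthogonal eigenspaces; only finitely many components occur, each with
eigenvalue above `t`. -/
theorem lt_re_inner_apply_self_of_mem_upperEigenspan {P : H →L[ℂ] H}
    (hP : (P : H →ₗ[ℂ] H).IsSymmetric) {t : ℝ} {x : H} (hx : x ∈ upperEigenspan P t)
    (hx0 : x ≠ 0) : t * ‖x‖ ^ 2 < (⟪P x, x⟫_ℂ).re := by
  rw [upperEigenspan, iSup_subtype', Submodule.mem_iSup_iff_exists_finsupp] at hx
  obtain ⟨f, hf, rfl⟩ := hx
  have hV := hP.orthogonalFamily_eigenspaces.comp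
    (γ := {μ : ℝ // t < μ}) (f := fun μ ↦ ((μ : ℝ) : ℂ))
    (Complex.ofReal_injective.comp Subtype.coe_injective)
  let g : ∀ μ : {μ : ℝ // t < μ},
    Module.End.eigenspace (P : Module.End ℂ H) ((μ : ℝ) : ℂ) := fun μ ↦ ⟨f μ, hf μ⟩
  have h1 : P (∑ μ ∈ f.support, f μ) = ∑ μ ∈ f.support, (((μ : ℝ) : ℂ) • g μ : H) := by
    rw [map_sum]
    exact Finset.sum_congr rfl fun μ _ ↦ Module.End.mem_eigenspace_iff.1 (hf μ)
  have h2 := hV.inner_sum (fun μ ↦ ((μ : ℝ) : ℂ) • g μ) g f.support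
  have h3 := hV.inner_sum g g f.support
  simp only [Submodule.coe_inner, Submodule.coe_smul, g] at h1 h2 h3
  change ⟪∑ μ ∈ f.support, ((μ : ℝ) : ℂ) • f μ, ∑ μ ∈ f.support, f μ⟫_ℂ = _ at h2
  change ⟪∑ μ ∈ f.support, f μ, ∑ μ ∈ f.support, f μ⟫_ℂ = _ at h3
  simp only [Finsupp.sum] at hx0 ⊢
  rw [← inner_self_eq_norm_sq (𝕜 := ℂ), h1, h2, h3, map_sum, Complex.re_sum, Finset.mul_sum]
  have h4 : ∀ μ : {μ : ℝ // t < μ}, (⟪((μ : ℝ) : ℂ) • f μ, f μ⟫_ℂ).re = μ * ‖f μ‖ ^ 2 := by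
    intro μ
    rw [inner_smul_left, Complex.conj_ofReal, Complex.re_ofReal_mul, ← RCLike.re_to_complex,
      inner_self_eq_norm_sq]
  simp only [h4, inner_self_eq_norm_sq]
  refine Finset.sum_lt_sum_of_nonempty ?_ fun μ hμ ↦ ?_
  · by_contra! h
    simp [h] at hx0
  · have : 0 < ‖f μ‖ := norm_pos_iff.2 (Finsupp.mem_support_iff.1 hμ)
    have := μ.2
    gcongr

theorem upperEigenspan_eq_bot_of_norm_le (P : H →L[ℂ] H) {t : ℝ} (ht : ‖P‖ ≤ t) :
    upperEigenspan P t = ⊥ := by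
  refine le_bot_iff.1 (iSup₂_le fun μ hμ x hx ↦ ?_)
  by_contra h
  have hx' : P x = (μ : ℂ) • x := Module.End.mem_eigenspace_iff.1 hx
  have hx0 : 0 < ‖x‖ := norm_pos_iff.2 h
  have h1 := P.le_opNorm x
  rw [hx', norm_smul, Complex.norm_real] at h1
  have := le_of_mul_le_mul_right h1 hx0
  linarith [Real.le_norm_self μ]

/-- Covers the noncompact summand `2 I` at an endpoint value of `α`. -/
theorem re_inner_apply_self_le_of_mem_upperEigenspan_orthogonal_smul_one (c t : ℝ) {x : H}
    (hx : x ∈ (upperEigenspan ((c : ℂ) • (1 : H →L[ℂ] H)) t)ᗮ) :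
    (⟪((c : ℂ) • (1 : H →L[ℂ] H)) x, x⟫_ℂ).re ≤ t * ‖x‖ ^ 2 := by
  have h1 : (⟪((c : ℂ) • (1 : H →L[ℂ] H)) x, x⟫_ℂ).re = c * ‖x‖ ^ 2 := by
    rw [smul_apply, one_apply_eq_self, inner_smul_left, Complex.conj_ofReal,
      Complex.re_ofReal_mul, ← RCLike.re_to_complex, inner_self_eq_norm_sq]
  rw [h1]
  rcases le_or_gt c t with h | h
  · gcongr
  · have h2 : x ∈ upperEigenspan ((c : ℂ) • (1 : H →L[ℂ] H)) t :=
      eigenspace_le_upperEigenspan _ h (Module.End.mem_eigenspace_iff.2 (by simp))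
    have h3 : x = 0 := inner_self_eq_zero.1 (Submodule.inner_right_of_mem_orthogonal h2 hx)
    simp [h3]

variable [CompleteSpace H]

theorem re_inner_apply_self_le_of_hasEigenvalue_le {S : H →L[ℂ] H}
    (hc : IsCompactOperator S) (hS : IsSelfAdjoint S) {t : ℝ} (ht : 0 ≤ t)
    (h : ∀ s : ℝ, Module.End.HasEigenvalue (S : Module.End ℂ H) (s : ℂ) → s ≤ t) (x : H) :
    (⟪S x, x⟫_ℂ).re ≤ t * ‖x‖ ^ 2 := by
  have hle : S ≤ algebraMap ℝ _ t := by
    refine le_algebraMap_of_spectrum_le fun s hs ↦ ?_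
    by_contra! hts
    have hs0 : (s : ℂ) ≠ 0 := by exact_mod_cast (ht.trans_lt hts).ne'
    exact hts.not_ge
      (h s ((hc.hasEigenvalue_iff_mem_spectrum hs0).2 (spectrum.algebraMap_mem ℂ hs)))
  have h1 := re_inner_apply_self_mono hle x
  rwa [Algebra.algebraMap_eq_smul_one, smul_apply, one_apply_eq_self, ← Complex.coe_smul,
    inner_smul_left, Complex.conj_ofReal, Complex.re_ofReal_mul, ← RCLike.re_to_complex,
    ← RCLike.re_to_complex, inner_self_eq_norm_sq] at h1

/-- The complement is invariant and `P` stays compact on it; an eigenvector there with eigenvalue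
above `t` would be orthogonal to itself. -/
theorem re_inner_apply_self_le_of_mem_upperEigenspan_orthogonal {P : H →L[ℂ] H}
    (hc : IsCompactOperator P) (hP : (P : H →ₗ[ℂ] H).IsSymmetric) {t : ℝ} (ht : 0 ≤ t) {x : H}
    (hx : x ∈ (upperEigenspan P t)ᗮ) : (⟪P x, x⟫_ℂ).re ≤ t * ‖x‖ ^ 2 := by
  have hinv : ∀ v ∈ (upperEigenspan P t)ᗮ, (P : H →ₗ[ℂ] H) v ∈ (upperEigenspan P t)ᗮ :=
    fun v hv ↦ apply_mem_upperEigenspan_orthogonal hP t hv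
  let S : (upperEigenspan P t)ᗮ →L[ℂ] (upperEigenspan P t)ᗮ := P.restrict hinv
  have hSc : IsCompactOperator S := hc.restrict' hinv
  have hSs : IsSelfAdjoint S :=
    ContinuousLinearMap.isSelfAdjoint_iff_isSymmetric.2 (hP.restrict_invariant hinv)
  refine re_inner_apply_self_le_of_hasEigenvalue_le hSc hSs ht (fun s hs ↦ ?_) ⟨x, hx⟩
  by_contra! hts
  obtain ⟨v, hv⟩ := hs.exists_hasEigenvector
  have hv1 : P v = (s : ℂ) • (v : H) := congrArg Subtype.val hv.apply_eq_smul
  have h2 : (v : H) ∈ upperEigenspan P t :=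
    eigenspace_le_upperEigenspan _ hts (Module.End.mem_eigenspace_iff.2 hv1)
  exact hv.2 (Subtype.ext
    (inner_self_eq_zero.1 (Submodule.inner_right_of_mem_orthogonal h2 v.2)))

theorem rank_absEigenspan_le (T : H →L[ℂ] H) (R : WithLp 2 (H × H) →L[ℂ] WithLp 2 (H × H)) {t : ℝ}
    (ht : 0 ≤ t) [FiniteDimensional ℂ (upperEigenspan R t)]
    (hT : ∀ x y, 2 * (⟪T x, y⟫_ℂ).re ≤ (⟪R (WithLp.toLp 2 (x, y)), WithLp.toLp 2 (x, y)⟫_ℂ).re)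
    (hR : ∀ v ∈ (upperEigenspan R t)ᗮ, (⟪R v, v⟫_ℂ).re ≤ t * ‖v‖ ^ 2) :
    Module.rank ℂ (absEigenspan T t) ≤ Module.rank ℂ (upperEigenspan R t) := by
  set P := CFC.abs T with hPdef
  have hPsa : IsSelfAdjoint P := .of_nonneg (CFC.abs_nonneg T)
  have hP : (P : H →ₗ[ℂ] H).IsSymmetric :=
    ContinuousLinearMap.isSelfAdjoint_iff_isSymmetric.1 hPsa
  have hPP : ∀ x y, ⟪T x, T y⟫_ℂ = ⟪P x, P y⟫_ℂ := by
    intro x y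
    have h1 := hP (P x) y
    simp only [ContinuousLinearMap.coe_coe] at h1
    rw [← h1, ← mul_apply_eq_comp P P, hPdef, CFC.abs_mul_abs, mul_apply_eq_comp,
      ContinuousLinearMap.star_eq_adjoint, ContinuousLinearMap.adjoint_inner_left]
  -- With the polar decomposition `T = U|T|` and `z = |T| x`, this is `(z, U z)`, for which the
  -- bound `hT` reads `2 ⟪|T| z, z⟫ ≤ ⟪R Φ x, Φ x⟫`, while `‖Φ x‖ ^ 2 = 2 ‖z‖ ^ 2`.
  let Φ : H →ₗ[ℂ] WithLp 2 (H × H) :=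
    (WithLp.linearEquiv 2 ℂ (H × H)).symm.toLinearMap ∘ₗ
      (P : H →ₗ[ℂ] H).prod (T : H →ₗ[ℂ] H)
  let Ψ : absEigenspan T t →ₗ[ℂ] upperEigenspan R t :=
    ((upperEigenspan R t).orthogonalProjectionOnto : _ →ₗ[ℂ] _) ∘ₗ Φ ∘ₗ (absEigenspan T t).subtype
  refine LinearMap.rank_le_of_injective Ψ ((injective_iff_map_eq_zero Ψ).2 ?_)
  rintro ⟨x, hx⟩ h0
  have hx' : x ∈ upperEigenspan P t := hx
  by_contra hne
  have hx0 : x ≠ 0 := fun h ↦ hne (Subtype.ext h)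
  have hmem : Φ x ∈ (upperEigenspan R t)ᗮ :=
    Submodule.orthogonalProjectionOnto_eq_zero_iff.1 h0
  have h1 := hR _ hmem
  have hz0 : P x ≠ 0 := by
    intro h
    have := lt_re_inner_apply_self_of_mem_upperEigenspan hP hx' hx0
    rw [h, inner_zero_left, Complex.zero_re] at this
    exact absurd this (not_lt.2 (by positivity))
  have h2 := lt_re_inner_apply_self_of_mem_upperEigenspan hP (apply_mem_upperEigenspan P t hx') hz0
  have h3 := hT (P x) (T x)
  rw [hPP] at h3
  have h4 : ‖Φ x‖ ^ 2 = 2 * ‖P x‖ ^ 2 := by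
    have h5 : ‖T x‖ ^ 2 = ‖P x‖ ^ 2 := by
      rw [← inner_self_eq_norm_sq (𝕜 := ℂ), hPP, inner_self_eq_norm_sq]
    rw [WithLp.prod_norm_sq_eq_of_L2, two_mul]
    nth_rw 2 [← h5]
    rfl
  rw [h4] at h1
  change (⟪R (WithLp.toLp 2 (P x, T x)), WithLp.toLp 2 (P x, T x)⟫_ℂ).re ≤ _ at h1
  linarith

theorem opSingularValue_le_of_rank_le {K : Type*} [NormedAddCommGroup K] [InnerProductSpace ℂ K]
    [CompleteSpace K] (T : H →L[ℂ] H) (R : K →L[ℂ] K) {j : ℕ} (hj : 1 ≤ j)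
    (h : ∀ t, 0 ≤ t → Module.rank ℂ (absEigenspan R t) < j →
      Module.rank ℂ (absEigenspan T t) < j) :
    opSingularValue T j ≤ opSingularValue R j := by
  -- No eigenvalue exceeds the norm, so the count there is `0 < j`; this is where `1 ≤ j` enters.
  refine csInf_le_csInf ⟨0, fun t ht ↦ ht.1⟩ ⟨‖CFC.abs R‖, norm_nonneg _, ?_⟩
    fun t ht ↦ ⟨ht.1, h t ht.1 ht.2⟩
  change Module.rank ℂ (upperEigenspan (CFC.abs R) _) < _
  rw [upperEigenspan_eq_bot_of_norm_le _ le_rfl, rank_bot]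
  exact_mod_cast hj

end

/-! ### Block diagonal operators -/

section
variable {H : Type*} [NormedAddCommGroup H] [InnerProductSpace ℂ H]

theorem opDirectSum_toLp (M N : H →L[ℂ] H) (x y : H) :
    opDirectSum M N (WithLp.toLp 2 (x, y)) = WithLp.toLp 2 (M x, N y) := rfl

theorem inner_opDirectSum_apply (M N : H →L[ℂ] H) (v w : WithLp 2 (H × H)) :
    ⟪opDirectSum M N v, w⟫_ℂ = ⟪M v.fst, w.fst⟫_ℂ + ⟪N v.snd, w.snd⟫_ℂ := rfl

theorem toLp_fst_mem_upperEigenspan_opDirectSum (M N : H →L[ℂ] H) (t : ℝ) {x : H}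
    (hx : x ∈ upperEigenspan M t) :
    WithLp.toLp 2 (x, (0 : H)) ∈ upperEigenspan (opDirectSum M N) t := by
  have : upperEigenspan M t ≤ (upperEigenspan (opDirectSum M N) t).comap
      ((WithLp.linearEquiv 2 ℂ (H × H)).symm.toLinearMap ∘ₗ LinearMap.inl ℂ H H) := by
    refine iSup₂_le fun μ hμ y hy ↦ eigenspace_le_upperEigenspan _ hμ ?_
    have hy' : M y = (μ : ℂ) • y := Module.End.mem_eigenspace_iff.1 hy
    rw [Module.End.mem_eigenspace_iff]
    change opDirectSum M N (WithLp.toLp 2 (y, 0)) = (μ : ℂ) • WithLp.toLp 2 (y, (0 : H))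
    rw [opDirectSum_toLp, hy', map_zero, ← WithLp.toLp_smul, Prod.smul_mk, smul_zero]
  exact this hx

theorem toLp_snd_mem_upperEigenspan_opDirectSum (M N : H →L[ℂ] H) (t : ℝ) {y : H}
    (hy : y ∈ upperEigenspan N t) :
    WithLp.toLp 2 ((0 : H), y) ∈ upperEigenspan (opDirectSum M N) t := by
  have : upperEigenspan N t ≤ (upperEigenspan (opDirectSum M N) t).comap
      ((WithLp.linearEquiv 2 ℂ (H × H)).symm.toLinearMap ∘ₗ LinearMap.inr ℂ H H) := by
    refine iSup₂_le fun μ hμ y hy ↦ eigenspace_le_upperEigenspan _ hμ ?_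
    have hy' : N y = (μ : ℂ) • y := Module.End.mem_eigenspace_iff.1 hy
    rw [Module.End.mem_eigenspace_iff]
    change opDirectSum M N (WithLp.toLp 2 (0, y)) = (μ : ℂ) • WithLp.toLp 2 ((0 : H), y)
    rw [opDirectSum_toLp, hy', map_zero, ← WithLp.toLp_smul, Prod.smul_mk, smul_zero]
  exact this hy

theorem re_inner_opDirectSum_le_of_mem_orthogonal {M N : H →L[ℂ] H} {t : ℝ}
    (hM : ∀ x ∈ (upperEigenspan M t)ᗮ, (⟪M x, x⟫_ℂ).re ≤ t * ‖x‖ ^ 2)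
    (hN : ∀ x ∈ (upperEigenspan N t)ᗮ, (⟪N x, x⟫_ℂ).re ≤ t * ‖x‖ ^ 2)
    {v : WithLp 2 (H × H)} (hv : v ∈ (upperEigenspan (opDirectSum M N) t)ᗮ) :
    (⟪opDirectSum M N v, v⟫_ℂ).re ≤ t * ‖v‖ ^ 2 := by
  rw [Submodule.mem_orthogonal] at hv
  have h1 := hM v.fst ((Submodule.mem_orthogonal _ _).2 fun u hu ↦ by
    simpa [WithLp.prod_inner_apply] using
      hv _ (toLp_fst_mem_upperEigenspan_opDirectSum M N t hu))
  have h2 := hN v.snd ((Submodule.mem_orthogonal _ _).2 fun u hu ↦ by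
    simpa [WithLp.prod_inner_apply] using
      hv _ (toLp_snd_mem_upperEigenspan_opDirectSum M N t hu))
  rw [inner_opDirectSum_apply, Complex.add_re, WithLp.prod_norm_sq_eq_of_L2, mul_add]
  exact add_le_add h1 h2

theorem opDirectSum_nonneg {M N : H →L[ℂ] H} (hM : 0 ≤ M) (hN : 0 ≤ N) :
    0 ≤ opDirectSum M N := by
  rw [ContinuousLinearMap.nonneg_iff_isPositive] at hM hN ⊢
  refine ⟨fun v w ↦ ?_, fun v ↦ ?_⟩
  · have h1 := hM.1 v.fst w.fst
    have h2 := hN.1 v.snd w.snd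
    exact congrArg₂ (· + ·) h1 h2
  · exact add_nonneg (hM.re_inner_nonneg_left v.fst) (hN.re_inner_nonneg_left v.snd)

variable [CompleteSpace H]

theorem isCompactOperator_star_mul_self {A : H →L[ℂ] H} (hA : IsCompactOperator A) :
    IsCompactOperator (star A * A) :=
  hA.clm_comp (star A)

theorem isCompactOperator_star_adjoint_mul_adjoint {A : H →L[ℂ] H} (hA : IsCompactOperator A) :
    IsCompactOperator (star (ContinuousLinearMap.adjoint A) * ContinuousLinearMap.adjoint A) := by
  rw [← ContinuousLinearMap.star_eq_adjoint, star_star]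
  exact hA.comp_clm (star A)

theorem re_inner_abs_rpow_add_le_of_mem_orthogonal {A B : H →L[ℂ] H}
    (hA : IsCompactOperator (star A * A)) (hB : IsCompactOperator (star B * B)) {β : ℝ}
    (hβ : 0 ≤ β) {t : ℝ} (ht : 0 ≤ t) {x : H}
    (hx : x ∈ (upperEigenspan (CFC.abs A ^ (2 * β) + CFC.abs B ^ (2 * β)) t)ᗮ) :
    (⟪(CFC.abs A ^ (2 * β) + CFC.abs B ^ (2 * β)) x, x⟫_ℂ).re ≤ t * ‖x‖ ^ 2 := by
  rcases hβ.eq_or_lt with rfl | hβ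
  · have h : CFC.abs A ^ (2 * (0 : ℝ)) + CFC.abs B ^ (2 * (0 : ℝ)) =
        ((2 : ℝ) : ℂ) • (1 : H →L[ℂ] H) := by
      rw [mul_zero, CFC.rpow_zero _ (CFC.abs_nonneg A), CFC.rpow_zero _ (CFC.abs_nonneg B),
        Complex.ofReal_ofNat, two_smul]
    rw [h] at hx ⊢
    exact re_inner_apply_self_le_of_mem_upperEigenspan_orthogonal_smul_one 2 t hx
  · refine re_inner_apply_self_le_of_mem_upperEigenspan_orthogonal
      ((isCompactOperator_abs_rpow hA hβ).add (isCompactOperator_abs_rpow hB hβ)) ?_ ht hx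
    exact ContinuousLinearMap.isSelfAdjoint_iff_isSymmetric.1
      (.of_nonneg (add_nonneg CFC.rpow_nonneg CFC.rpow_nonneg))

end

theorem theorem2p3 {H : Type*} [NormedAddCommGroup H] [InnerProductSpace ℂ H] [CompleteSpace H]
    (A B : H →L[ℂ] H) (hA : IsCompactOperator A) (hB : IsCompactOperator B)
    (α : ℝ) (hα₀ : 0 ≤ α) (hα₁ : α ≤ 1) (j : ℕ) (hj : 1 ≤ j) :
    opSingularValue (A + B) j ≤
      opSingularValue
        (opDirectSum
          (CFC.abs A ^ (2 * α) + CFC.abs B ^ (2 * α))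
          (CFC.abs (ContinuousLinearMap.adjoint A) ^ (2 * (1 - α)) +
            CFC.abs (ContinuousLinearMap.adjoint B) ^ (2 * (1 - α)))) j := by
  refine opSingularValue_le_of_rank_le _ _ hj fun t ht hrank ↦ ?_
  have hα' : 0 ≤ 1 - α := sub_nonneg.2 hα₁
  set M := CFC.abs A ^ (2 * α) + CFC.abs B ^ (2 * α) with hM
  set N := CFC.abs (ContinuousLinearMap.adjoint A) ^ (2 * (1 - α)) +
    CFC.abs (ContinuousLinearMap.adjoint B) ^ (2 * (1 - α)) with hN
  have hR0 : 0 ≤ opDirectSum M N := opDirectSum_nonneg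
    (add_nonneg CFC.rpow_nonneg CFC.rpow_nonneg) (add_nonneg CFC.rpow_nonneg CFC.rpow_nonneg)
  have hspan : absEigenspan (opDirectSum M N) t = upperEigenspan (opDirectSum M N) t := by
    change upperEigenspan (CFC.abs (opDirectSum M N)) t = _
    rw [CFC.abs_of_nonneg _ hR0]
  rw [hspan] at hrank
  -- Only levels `t` with fewer than `j` eigenvalues above them matter, so the orthogonal projection
  -- needed in the dimension count exists.
  have : FiniteDimensional ℂ (upperEigenspan (opDirectSum M N) t) :=
    Module.rank_lt_aleph0_iff.1 (hrank.trans (Cardinal.natCast_lt_aleph0))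
  refine (rank_absEigenspan_le _ _ ht (fun x y ↦ ?_) fun v hv ↦
    re_inner_opDirectSum_le_of_mem_orthogonal (fun x hx ↦ ?_) (fun x hx ↦ ?_) hv).trans_lt hrank
  · have h1 := two_re_inner_apply_le A hα₀ hα₁ x y
    have h2 := two_re_inner_apply_le B hα₀ hα₁ x y
    rw [inner_opDirectSum_apply, hM, hN]
    simp only [WithLp.fst, WithLp.snd]
    simp only [add_apply, inner_add_left, Complex.add_re]
    linarith
  · exact re_inner_abs_rpow_add_le_of_mem_orthogonal (isCompactOperator_star_mul_self hA)
      (isCompactOperator_star_mul_self hB) hα₀ ht hx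
  · exact re_inner_abs_rpow_add_le_of_mem_orthogonal
      (isCompactOperator_star_adjoint_mul_adjoint hA)
      (isCompactOperator_star_adjoint_mul_adjoint hB) hα' ht hx
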